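/- Let $T=\{3412,3421,2341\}$, let $S_n(T)$ be the set of permutations of $\{1,\dots,n\}$ that contain no pattern from $T$ (a permutation contains a pattern if it has a subsequence order-isomorphic to it), and let $F_T(x)=\sum_{n\ge 0}|S_n(T)|\,x^n$ be the generating function of the $T$-avoiders. Define \[ r=r(x)=\frac{(\sqrt5-1)\left(1-\sqrt{1-(3+\sqrt5)x+\tfrac12(3-\sqrt5)x^2}\right)-(1+\sqrt5)x}{4x}, \] where the square root is the formal power series with constant term $1$, and let $t=t(x)$ be the same expression with $\sqrt5$ replaced by $-\sqrt5$ throughout. Then $r$ and $t$ are nonzero formal power series over $\mathbb{R}$, both $v=r+1$ and $v=t+1$ satisfy \[ x^2v^4+x(1-3x)v^3+(x^2-1)v^2+(2-x)v-1=0, \] and, in the field of formal Laurent series over $\mathbb{R}$, $1+\frac1r+\frac1t-\frac1x\neq 0$ and \[ F_T(x)=1+\frac{1+rt}{1+\frac1r+\frac1t-\frac1x}. \] -/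

import Mathlib

open scoped PowerSeries LaurentSeries

namespace PatternAvoidance

/-- `π` contains the pattern `σ`: some subsequence of `π`, at increasing positions, is
order-isomorphic to `σ`. -/
def Contains {k n : ℕ} (π : Equiv.Perm (Fin n)) (σ : Equiv.Perm (Fin k)) : Prop :=
  ∃ f : Fin k ↪o Fin n, ∀ i j : Fin k, π (f i) < π (f j) ↔ σ i < σ j

/-- `S_n(T)`: the permutations of length `n` that contain no pattern of `T`. -/
def avoiders {k : ℕ} (T : Set (Equiv.Perm (Fin k))) (n : ℕ) : Set (Equiv.Perm (Fin n)) :=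
  {π | ∀ σ ∈ T, ¬ Contains π σ}

/-- `F_T(x) = ∑ |S_n(T)| xⁿ`, with real coefficients. -/
noncomputable def genFun {k : ℕ} (T : Set (Equiv.Perm (Fin k))) : ℝ⟦X⟧ :=
  PowerSeries.mk fun n => ((avoiders T n).ncard : ℝ)

/-- The pattern `3412`, in one-line notation with the letters `1,2,3,4` written `0,1,2,3`. -/
def p3412 : Equiv.Perm (Fin 4) :=
  ⟨![2, 3, 0, 1], ![2, 3, 0, 1], by decide, by decide⟩

/-- The pattern `3421`. -/
def p3421 : Equiv.Perm (Fin 4) :=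
  ⟨![2, 3, 1, 0], ![3, 2, 0, 1], by decide, by decide⟩

/-- The pattern `2341`. -/
def p2341 : Equiv.Perm (Fin 4) :=
  ⟨![1, 2, 3, 0], ![3, 0, 1, 2], by decide, by decide⟩

/-- The square root of a formal power series with constant term `1`, as the binomial series
`∑ (1/2 choose m) (f - 1)^m`. -/
noncomputable def sqrtSeries (f : ℝ⟦X⟧) : ℝ⟦X⟧ :=
  (PowerSeries.binomialSeries ℝ (1 / 2 : ℝ)).subst (f - 1)

theorem hasSubst_sub_one {f : ℝ⟦X⟧} (hf : PowerSeries.constantCoeff f = 1) :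
    PowerSeries.HasSubst (f - 1) :=
  PowerSeries.HasSubst.of_constantCoeff_zero' (by simp [hf])

theorem sqrtSeries_sq {f : ℝ⟦X⟧} (hf : PowerSeries.constantCoeff f = 1) :
    sqrtSeries f ^ 2 = f := by
  have h := hasSubst_sub_one hf
  have hb : PowerSeries.binomialSeries ℝ (1 / 2 : ℝ) * PowerSeries.binomialSeries ℝ (1 / 2 : ℝ)
      = 1 + PowerSeries.X := by
    rw [← PowerSeries.binomialSeries_add]
    have := PowerSeries.binomialSeries_nat (R := ℝ) (A := ℝ) 1
    norm_num at this ⊢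
    exact this
  have h1 : PowerSeries.subst (f - 1) (1 : ℝ⟦X⟧) = (1 : ℝ⟦X⟧) := by
    rw [← PowerSeries.coe_substAlgHom h, map_one]
  rw [pow_two, sqrtSeries, ← PowerSeries.subst_mul h, hb, PowerSeries.subst_add h,
    PowerSeries.subst_X h, h1]
  ring

theorem constantCoeff_sqrtSeries {f : ℝ⟦X⟧} (hf : PowerSeries.constantCoeff f = 1) :
    PowerSeries.constantCoeff (sqrtSeries f) = 1 := by
  have h := hasSubst_sub_one hf
  have hd : (PowerSeries.X : ℝ⟦X⟧) ∣ PowerSeries.binomialSeries ℝ (1 / 2 : ℝ) - 1 := by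
    rw [PowerSeries.X_dvd_iff]; simp
  obtain ⟨g, hg⟩ := hd
  rw [sub_eq_iff_eq_add] at hg
  have h1 : PowerSeries.subst (f - 1) (1 : ℝ⟦X⟧) = (1 : ℝ⟦X⟧) := by
    rw [← PowerSeries.coe_substAlgHom h, map_one]
  rw [sqrtSeries, hg, PowerSeries.subst_add h, PowerSeries.subst_mul h, PowerSeries.subst_X h, h1]
  simp [hf]

/-- `1 - (3 + s) x + (1/2) (3 - s) x²`. -/
noncomputable def radicand (s : ℝ) : ℝ⟦X⟧ :=
  1 - PowerSeries.C (3 + s) * PowerSeries.X + PowerSeries.C ((3 - s) / 2) * PowerSeries.X ^ 2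

/-- `((s - 1) (1 - √(1 - (3 + s) x + (1/2) (3 - s) x²)) - (1 + s) x) / (4 x)` in the field of
formal Laurent series; it is `r` for `s = √5` and `t` for `s = -√5`. -/
noncomputable def branch (s : ℝ) : ℝ⸨X⸩ :=
  ((PowerSeries.C (s - 1) * (1 - sqrtSeries (radicand s))
      - PowerSeries.C (1 + s) * PowerSeries.X : ℝ⟦X⟧) : ℝ⸨X⸩)
    / ((4 * PowerSeries.X : ℝ⟦X⟧) : ℝ⸨X⸩)

/-- The kernel `K(x,v) = x²v⁴ + x(1-3x)v³ + (x²-1)v² + (2-x)v - 1` at a power series `v`. -/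
noncomputable def kernel (v : ℝ⟦X⟧) : ℝ⟦X⟧ :=
  PowerSeries.X ^ 2 * v ^ 4 + PowerSeries.X * (1 - 3 * PowerSeries.X) * v ^ 3
    + (PowerSeries.X ^ 2 - 1) * v ^ 2 + (2 - PowerSeries.X) * v - 1

end PatternAvoidance

namespace PatternAvoidance

/-! Each forbidden pattern is a 231 or a 123 followed by an entry smaller than its first letter. So
a permutation can be grown by appending last entries: the new entry must exceed every bad entry,
that is, every first letter of a 231 or 123 (`avoids_append_iff`).

The growth depends on two parameters only. Let `m - 1` be the largest bad entry (`m = 0` if there is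
none), let `p` count the entries at least `m` that have a larger entry to their right, and let `d =
n - m - p`. Then a permutation labelled `(p, d)` has `p` children labelled `(0, d)`, one labelled
`(p, d + 1)`, and one labelled `(i + 1, d - i)` for each `i < d` (`isState_state`, `stateSum_succ`).

Weighting by `u ^ d` and by `p * u ^ d` gives two series `A` and `B` satisfying a linear system that
also involves `F = A(1)` and `D = A'(1)`. After `B` is eliminated, the coefficient of `A` vanishes
at `u = 1 + k r` when `k ^ 2 = k + 1` and `x (1 + k r) (1 + r) = r` (`kernel_method`). The two
golden-ratio values of `k` give `r` and `t` (`exists_branch`), hence two linear equations in `F` and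
`D`, and eliminating `D` yields `F` (`closed_form`). -/

/-! ### Formal sums of power series. -/

open PowerSeries in
/-- The formal sum `∑ Xⁱ gᵢ`. -/
noncomputable def xSum (g : ℕ → ℝ⟦X⟧) : ℝ⟦X⟧ :=
  PowerSeries.mk fun n => coeff n (∑ i ∈ Finset.range (n + 1), X ^ i * g i)

theorem xSum_add (g h : ℕ → ℝ⟦X⟧) : xSum (fun n => g n + h n) = xSum g + xSum h := by
  ext n
  simp [xSum, mul_add, Finset.sum_add_distrib]

theorem xSum_succ (g : ℕ → ℝ⟦X⟧) :
    xSum g = g 0 + PowerSeries.X * xSum (fun n => g (n + 1)) := by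
  ext n
  cases n with
  | zero => simp [xSum]
  | succ n =>
    rw [map_add, PowerSeries.coeff_succ_X_mul, xSum, PowerSeries.coeff_mk,
      Finset.sum_range_succ', xSum, PowerSeries.coeff_mk, map_add, add_comm]
    congr 1
    · simp
    · simp only [pow_succ', mul_assoc]
      rw [← Finset.mul_sum, PowerSeries.coeff_succ_X_mul]

theorem coeff_xSum_of_le (g : ℕ → ℝ⟦X⟧) {k n : ℕ} (h : k ≤ n) :
    PowerSeries.coeff k (xSum g)
      = PowerSeries.coeff k (∑ i ∈ Finset.range (n + 1), PowerSeries.X ^ i * g i) := by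
  induction n, h using Nat.le_induction with
  | base => simp [xSum]
  | succ n hn ih =>
    rw [ih, Finset.sum_range_succ _ (n + 1), map_add, PowerSeries.coeff_X_pow_mul',
      if_neg (by omega), add_zero]

theorem xSum_mul_left (c : ℝ⟦X⟧) (g : ℕ → ℝ⟦X⟧) :
    xSum (fun n => c * g n) = c * xSum g := by
  ext n
  rw [coeff_xSum_of_le _ le_rfl, PowerSeries.coeff_mul]
  have : ∑ i ∈ Finset.range (n + 1), PowerSeries.X ^ i * (c * g i)
      = c * ∑ i ∈ Finset.range (n + 1), PowerSeries.X ^ i * g i := by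
    rw [Finset.mul_sum]
    exact Finset.sum_congr rfl fun i _ => by ring
  rw [this, PowerSeries.coeff_mul]
  refine Finset.sum_congr rfl fun ij hij => ?_
  rw [coeff_xSum_of_le g (by have := Finset.HasAntidiagonal.mem_antidiagonal.1 hij; omega : ij.2 ≤ n)]

theorem xSum_C (a : ℕ → ℝ) : xSum (fun n => PowerSeries.C (a n)) = PowerSeries.mk a := by
  ext n
  rw [xSum, PowerSeries.coeff_mk, PowerSeries.coeff_mk, map_sum,
    Finset.sum_eq_single n]
  · simp
  · intro i hi hne
    rw [PowerSeries.coeff_X_pow_mul', PowerSeries.coeff_C]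
    have := Finset.mem_range.1 hi
    rw [if_pos (by omega), if_neg (by omega)]
  · simp

/-! ### The two branches as roots of quadratics. -/

theorem C_half_one_add_sq {s : ℝ} (hs : s ^ 2 = 5) :
    (PowerSeries.C ((1 + s) / 2) : ℝ⟦X⟧) ^ 2 = PowerSeries.C ((1 + s) / 2) + 1 := by
  rw [← map_pow, show ((1 + s) / 2) ^ 2 = (1 + s) / 2 + 1 by linarith [hs], map_add, map_one]

/-- For `s ^ 2 = 5`, `branch s` is a power series `r` with
`x (1 + (1 + s) / 2 * r) (1 + r) = r`. -/
theorem exists_branch {s : ℝ} (hs : s ^ 2 = 5) :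
    ∃ r : ℝ⟦X⟧, (r : ℝ⸨X⸩) = branch s ∧
      PowerSeries.X * (1 + PowerSeries.C ((1 + s) / 2) * r) * (1 + r) = r := by
  have hc : PowerSeries.constantCoeff (radicand s) = 1 := by simp [radicand]
  have hg := sqrtSeries_sq hc
  have hg0 := constantCoeff_sqrtSeries hc
  set g := sqrtSeries (radicand s) with hgdef
  obtain ⟨q, hq⟩ : (PowerSeries.X : ℝ⟦X⟧) ∣ PowerSeries.C (s - 1) * (1 - g)
      - PowerSeries.C (1 + s) * PowerSeries.X := by
    rw [PowerSeries.X_dvd_iff]; simp [hg0]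
  have h4 : (4 : ℝ⟦X⟧) * PowerSeries.C (1 / 4) = 1 := by
    rw [show (4 : ℝ⟦X⟧) = PowerSeries.C 4 from (map_ofNat _ 4).symm, ← map_mul]; norm_num
  have hnum : PowerSeries.C (s - 1) * (1 - g) - PowerSeries.C (1 + s) * PowerSeries.X
      = (4 * PowerSeries.X : ℝ⟦X⟧) * (PowerSeries.C (1 / 4) * q) := by
    rw [hq]; linear_combination -PowerSeries.X * q * h4
  have h4X : (4 * PowerSeries.X : ℝ⟦X⟧) ≠ 0 := mul_ne_zero (left_ne_zero_of_mul_eq_one h4)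
    PowerSeries.X_ne_zero
  generalize PowerSeries.C (1 / 4) * q = r at hnum
  refine ⟨r, ?_, ?_⟩
  · rw [branch, ← hgdef, hnum, PowerSeries.coe_mul, mul_comm, mul_div_cancel_right₀]
    exact (map_ne_zero_iff (HahnSeries.ofPowerSeries ℤ ℝ)
      HahnSeries.ofPowerSeries_injective).2 h4X
  · set k : ℝ⟦X⟧ := PowerSeries.C ((1 + s) / 2) with hkdef
    have hk := C_half_one_add_sq hs
    rw [← hkdef] at hk
    have h1 : (PowerSeries.C (s - 1) : ℝ⟦X⟧) = 2 * (k - 1) := by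
      rw [hkdef, ← map_one PowerSeries.C, ← map_sub, ← map_ofNat PowerSeries.C 2, ← map_mul]
      ring_nf
    have h2 : (PowerSeries.C (1 + s) : ℝ⟦X⟧) = 2 * k := by
      rw [hkdef, ← map_ofNat PowerSeries.C 2, ← map_mul]
      ring_nf
    have h3 : (PowerSeries.C (3 + s) : ℝ⟦X⟧) = 2 + 2 * k := by
      rw [← h2, ← map_ofNat PowerSeries.C 2, ← map_add]
      ring_nf
    have h5 : (PowerSeries.C ((3 - s) / 2) : ℝ⟦X⟧) = 2 - k := by
      rw [hkdef, ← map_ofNat PowerSeries.C 2, ← map_sub]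
      ring_nf
    rw [h1, h2] at hnum
    rw [radicand, h3, h5] at hg
    generalize (PowerSeries.X : ℝ⟦X⟧) = x at *
    -- The quadratic formula with `1 / k = k - 1`: the radicand is the discriminant `(1 - (1 + k)
    -- x)² - 4 k x²`, so squaring this relation recovers the quadratic for `r`.
    have hE : (k - 1) * g = (k - 1) - k * x - 2 * x * r := by
      apply mul_left_cancel₀ (show (2 : ℝ⟦X⟧) ≠ 0 from fun h => by
        have h0 := congrArg PowerSeries.constantCoeff h
        rw [map_ofNat, map_zero] at h0
        norm_num at h0)
      linear_combination -hnum
    apply mul_left_cancel₀ h4X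
    linear_combination (-k) * ((k - 1) * g + ((k - 1) - k * x - 2 * x * r)) * hE
      + k * (k - 1) ^ 2 * hg
      - (2 * k * (k - 1) * x + (k ^ 2 - 2 * k + 4) * x ^ 2 - 4 * x * r + 4 * x ^ 2 * r) * hk

theorem kernel_branch {s : ℝ} (hs : s ^ 2 = 5) {r : ℝ⟦X⟧}
    (h : PowerSeries.X * (1 + PowerSeries.C ((1 + s) / 2) * r) * (1 + r) = r) :
    kernel (r + 1) = 0 := by
  have hk := C_half_one_add_sq hs
  rw [kernel]
  generalize (PowerSeries.C ((1 + s) / 2) : ℝ⟦X⟧) = k at *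
  generalize (PowerSeries.X : ℝ⟦X⟧) = x at *
  -- With `E = x (1 + r) - r` and `G = x r (1 + r)`, the kernel is `-(E² + E G - G²) = -(E + k G) (E
  -- + (1 - k) G)`, and `h` says `E + k G = 0`.
  linear_combination (-(x * (1 + r) - r + (1 - k) * (x * r * (1 + r)))) * h
    - (x * r * (1 + r)) ^ 2 * hk

theorem branch_ne_zero {k r : ℝ⟦X⟧} (h : PowerSeries.X * (1 + k * r) * (1 + r) = r) : r ≠ 0 := by
  rintro rfl
  simp [PowerSeries.X_ne_zero] at h

theorem constantCoeff_branch {k r : ℝ⟦X⟧} (h : PowerSeries.X * (1 + k * r) * (1 + r) = r) :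
    PowerSeries.constantCoeff r = 0 := by
  rw [← h]
  simp

/-! ### Elimination in the functional equations. -/

/-- The kernel method: substituting a root of the kernel eliminates `A` and `B`. -/
theorem kernel_method {R : Type*} [CommRing R] [IsDomain R] {x k r u A B D a : R}
    (hr : r ≠ 0) (hk : k ^ 2 = k + 1)
    (h : x * (1 + k * r) * (1 + r) = r) (hu : u = 1 + k * r)
    (hA : (1 - u) * A = (1 - u) + x * ((1 - u) * B + u * (1 - u) * A + u * (a - A)))
    (hB : (1 - u) ^ 2 * B = x * (u * (1 - u) ^ 2 * B + u * ((1 - u) * D - u * (a - A)))) :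
    k * a = k * (1 + r) - x * D * (1 + r) := by
  have hk0 : k ≠ 0 := by
    rintro rfl
    simp at hk
  have h' : x * u * (1 + r) = r := by rw [hu, h]
  have e1 : (1 - u) * A = (1 + r) * (1 - u) + x * (1 + r) * (1 - u) * B + r * (a - A) := by
    linear_combination (1 + r) * hA + ((1 - u) * A + (a - A)) * h'
  have e2 : (1 - u) ^ 2 * B = r * ((1 - u) * D - u * (a - A)) := by
    linear_combination (1 + r) * hB + ((1 - u) ^ 2 * B + (1 - u) * D - u * (a - A)) * h'
  -- Eliminating `B` leaves `A` with coefficient `(1 - u) (1 - u + r) - r² = r² (k² - k - 1) = 0`.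
  apply mul_left_cancel₀ (mul_ne_zero hk0 (pow_ne_zero 2 hr))
  subst hu
  linear_combination (1 - (1 + k * r)) * e1 + x * (1 + r) * e2 - r * (a - A) * h'
    + r ^ 2 * (a - A) * hk

theorem closed_form {R : Type*} [CommRing R] [IsDomain R] {x k r t D a : R}
    (hx : x ≠ 0) (hk : k ^ 2 = k + 1)
    (hr : x * (1 + k * r) * (1 + r) = r) (ht : x * (1 + (1 - k) * t) * (1 + t) = t)
    (hne : k * (1 + t) - (1 - k) * (1 + r) ≠ 0)
    (h1 : k * a = k * (1 + r) - x * D * (1 + r))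
    (h2 : (1 - k) * a = (1 - k) * (1 + t) - x * D * (1 + t)) :
    a * (1 - r * t) = (1 - r * t) + x * (1 + r * t) * (1 + r) * (1 + t) := by
  have h3 : a * (k * (1 + t) - (1 - k) * (1 + r)) = (2 * k - 1) * (1 + r) * (1 + t) := by
    linear_combination (1 + t) * h1 - (1 + r) * h2
  -- Eliminating the right-hand sides between the two quadratics leaves a multiple of `x`.
  have h4 : r - t = r * t * (2 * k - 1 + k * r - (1 - k) * t) := by
    apply mul_left_cancel₀ hx
    linear_combination r * ht - t * hr
  apply mul_left_cancel₀ hne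
  linear_combination (1 - r * t) * h3 - (1 - r * t) * k * (1 + t) * hr
    + (1 - r * t) * (1 - k) * (1 + r) * ht + 2 * x * (1 + r) * (1 + t) * h4
    + (1 - r * t) * x * (1 + r) * (1 + t) * (r - t) * hk

/-! ### Reformulating avoidance. -/

/-- The entries at the positions `i < j < k` form a pattern `231` or `123`. -/
def IsBadTriple {n : ℕ} (π : Equiv.Perm (Fin n)) (i j k : Fin n) : Prop :=
  i < j ∧ j < k ∧ π i < π j ∧ (π k < π i ∨ π j < π k)

/-- `b` is the first entry of a pattern `231` or `123` in `π`. -/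
def IsBad {n : ℕ} (π : Equiv.Perm (Fin n)) (b : ℕ) : Prop :=
  ∃ i j k, IsBadTriple π i j k ∧ (π i : ℕ) = b

/-- Some entry to the right of `b` exceeds `b`. -/
def HasAscent {n : ℕ} (π : Equiv.Perm (Fin n)) (b : ℕ) : Prop :=
  ∃ i j, i < j ∧ π i < π j ∧ (π i : ℕ) = b

/-- `π` avoids `3412`, `3421` and `2341`, stated without order embeddings. -/
def Avoids {n : ℕ} (π : Equiv.Perm (Fin n)) : Prop :=
  ∀ i j k l, IsBadTriple π i j k → k < l → ¬ π l < π i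

theorem contains_of_lt {n : ℕ} (π : Equiv.Perm (Fin n)) (σ : Equiv.Perm (Fin 4))
    {i j k l : Fin n} (hij : i < j) (hjk : j < k) (hkl : k < l)
    (h : ∀ a b : Fin 4, σ a < σ b → π (![i, j, k, l] a) < π (![i, j, k, l] b)) :
    Contains π σ := by
  have hmono : StrictMono ![i, j, k, l] := by
    rw [Fin.strictMono_iff_lt_succ]
    intro a
    fin_cases a <;> assumption
  refine ⟨OrderEmbedding.ofStrictMono _ hmono, fun a b => ⟨fun hab => ?_, h a b⟩⟩
  rcases lt_trichotomy (σ a) (σ b) with hlt | heq | hgt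
  · exact hlt
  · rw [σ.injective heq] at hab
    exact absurd hab (lt_irrefl _)
  · exact absurd hab (lt_asymm (h b a hgt))

theorem mem_avoiders_iff {n : ℕ} (π : Equiv.Perm (Fin n)) :
    π ∈ avoiders {p3412, p3421, p2341} n ↔ Avoids π := by
  constructor
  · intro h i j k l ⟨hij, hjk, hπ, hor⟩ hkl hl
    have h1 := h p3412 (by simp)
    have h2 := h p3421 (by simp)
    have h3 := h p2341 (by simp)
    have hne : π k ≠ π l := fun e => hkl.ne (π.injective e)
    rcases hor with hk | hk
    · rcases lt_or_gt_of_ne hne with hlt | hgt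
      · refine h1 (contains_of_lt π _ hij hjk hkl fun a b hab => ?_)
        fin_cases a <;> fin_cases b <;> first | exact absurd hab (by decide) | (simp; order)
      · refine h2 (contains_of_lt π _ hij hjk hkl fun a b hab => ?_)
        fin_cases a <;> fin_cases b <;> first | exact absurd hab (by decide) | (simp; order)
    · refine h3 (contains_of_lt π _ hij hjk hkl fun a b hab => ?_)
      fin_cases a <;> fin_cases b <;> first | exact absurd hab (by decide) | (simp; order)
  · rintro h σ hσ ⟨f, hf⟩
    have hf01 : f 0 < f 1 := f.strictMono (by decide)
    have hf12 : f 1 < f 2 := f.strictMono (by decide)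
    have hf23 : f 2 < f 3 := f.strictMono (by decide)
    refine h (f 0) (f 1) (f 2) (f 3) ⟨hf01, hf12, ?_, ?_⟩ hf23 ?_
    · rcases hσ with rfl | rfl | rfl <;> exact (hf _ _).2 (by decide)
    · rcases hσ with rfl | rfl | rfl
      · exact Or.inl ((hf _ _).2 (by decide))
      · exact Or.inl ((hf _ _).2 (by decide))
      · exact Or.inr ((hf _ _).2 (by decide))
    · rcases hσ with rfl | rfl | rfl <;> exact (hf _ _).2 (by decide)

/-! ### Growing permutations by a last entry. -/

/-- Append a last entry `h` to `π`, raising the entries that are at least `h`. -/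
def append {n : ℕ} (h : Fin (n + 1)) (π : Equiv.Perm (Fin n)) : Equiv.Perm (Fin (n + 1)) :=
  (finSuccEquiv' (Fin.last n)).trans ((Equiv.optionCongr π).trans (finSuccEquiv' h).symm)

@[simp] theorem append_last {n : ℕ} (h : Fin (n + 1)) (π : Equiv.Perm (Fin n)) :
    append h π (Fin.last n) = h := by
  simp [append]

@[simp] theorem append_castSucc {n : ℕ} (h : Fin (n + 1)) (π : Equiv.Perm (Fin n)) (i : Fin n) :
    append h π i.castSucc = h.succAbove (π i) := by
  rw [append, Equiv.trans_apply, ← Fin.succAbove_last_apply, finSuccEquiv'_succAbove]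
  simp

theorem append_injective (n : ℕ) :
    Function.Injective fun q : Fin (n + 1) × Equiv.Perm (Fin n) => append q.1 q.2 := by
  rintro ⟨h, π⟩ ⟨h', π'⟩ e
  have e' : append h π = append h' π' := e
  have hh : h = h' := by rw [← append_last h π, e', append_last]
  subst hh
  have : π = π' := by
    ext1 i
    apply h.succAbove_right_injective
    rw [← append_castSucc, e', append_castSucc]
  rw [this]

/-- Splitting off the last entry of a permutation. -/
noncomputable def appendEquiv (n : ℕ) :
    Fin (n + 1) × Equiv.Perm (Fin n) ≃ Equiv.Perm (Fin (n + 1)) :=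
  Equiv.ofBijective (fun q => append q.1 q.2)
    ((Fintype.bijective_iff_injective_and_card _).2 ⟨append_injective n, by
      simp [Fintype.card_perm, Nat.factorial_succ]⟩)

theorem val_succAbove {n : ℕ} (h : Fin (n + 1)) (b : Fin n) :
    ((b : ℕ) < h ∧ (h.succAbove b : ℕ) = b) ∨ ((h : ℕ) ≤ b ∧ (h.succAbove b : ℕ) = b + 1) := by
  rcases lt_or_ge b.castSucc h with hlt | hge
  · exact Or.inl ⟨hlt, by rw [Fin.succAbove_of_castSucc_lt _ _ hlt]; rfl⟩
  · exact Or.inr ⟨hge, by rw [Fin.succAbove_of_le_castSucc _ _ hge]; rfl⟩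

/-- A forbidden pattern absent from `π` must use the new entry as its last letter, placed below the
first letter of a bad triple of `π`. -/
theorem avoids_append_iff {n : ℕ} (h : Fin (n + 1)) (π : Equiv.Perm (Fin n)) :
    Avoids (append h π) ↔ Avoids π ∧ ∀ b, IsBad π b → b < h := by
  constructor
  · intro H
    refine ⟨fun i j k l ⟨hij, hjk, hπ, hor⟩ hkl hl => ?_, ?_⟩
    · refine H i.castSucc j.castSucc k.castSucc l.castSucc ⟨hij, hjk, ?_, ?_⟩ hkl ?_ <;>
        simpa using by assumption
    · rintro b ⟨i, j, k, ⟨hij, hjk, hπ, hor⟩, rfl⟩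
      by_contra hb
      refine H i.castSucc j.castSucc k.castSucc (Fin.last n) ⟨hij, hjk, ?_, ?_⟩
        (Fin.castSucc_lt_last k) ?_
      · simpa using hπ
      · simpa using hor
      · rw [append_last, append_castSucc, Fin.lt_def]
        have := val_succAbove h (π i)
        omega
  · rintro ⟨H, hb⟩ i j k l ⟨hij, hjk, hπ, hor⟩ hkl hl
    obtain ⟨k, rfl⟩ := Fin.exists_castSucc_eq.2 (Fin.ne_last_of_lt hkl)
    obtain ⟨j, rfl⟩ := Fin.exists_castSucc_eq.2 (Fin.ne_last_of_lt hjk)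
    obtain ⟨i, rfl⟩ := Fin.exists_castSucc_eq.2 (Fin.ne_last_of_lt hij)
    simp only [append_castSucc, Fin.succAbove_lt_succAbove_iff, Fin.castSucc_lt_castSucc_iff]
      at hij hjk hπ hor hl
    have hT : IsBadTriple π i j k := ⟨hij, hjk, hπ, hor⟩
    induction l using Fin.lastCases with
    | last =>
      have h1 := hb _ ⟨i, j, k, hT, rfl⟩
      rw [append_last, Fin.lt_def] at hl
      have := val_succAbove h (π i)
      omega
    | cast l =>
      rw [append_castSucc, Fin.succAbove_lt_succAbove_iff] at hl
      exact H i j k l hT hkl hl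

/-! ### How an appended entry changes the state. -/

/-- `π` has largest bad entry `m - 1`, and the entries `≥ m` with an ascent are `m, …, m + p - 1`,
which for `p > 0` are exactly the entries between `m` and the last one. -/
structure IsState {n : ℕ} (π : Equiv.Perm (Fin n)) (m p : ℕ) : Prop where
  le : m + p ≤ n
  bad : m = 0 ∨ IsBad π (m - 1)
  not_bad : ∀ b, m ≤ b → ¬ IsBad π b
  ascent_iff : ∀ b, m ≤ b → (HasAscent π b ↔ b < m + p)
  last : 0 < p → ∃ i, (∀ j, j ≤ i) ∧ (π i : ℕ) = m + p

theorem IsState.active_iff {n : ℕ} {π : Equiv.Perm (Fin n)} {m p : ℕ} (hs : IsState π m p)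
    (h : ℕ) : (∀ b, IsBad π b → b < h) ↔ m ≤ h := by
  constructor
  · intro H
    rcases hs.bad with h0 | h0
    · omega
    · have := H _ h0
      omega
  · intro H b hb
    by_contra hlt
    exact hs.not_bad b (by omega) hb

/-- A new bad triple is an ascent of `π` followed by the new entry: `h ≤ π i` makes it a 231, `π j <
h` a 123. -/
theorem isBad_append_iff {n : ℕ} (h : Fin (n + 1)) (π : Equiv.Perm (Fin n)) (b : ℕ) :
    IsBad (append h π) b ↔ ∃ i : Fin n, (h.succAbove (π i) : ℕ) = b ∧
      (IsBad π (π i) ∨ ∃ j, i < j ∧ π i < π j ∧ ((h : ℕ) ≤ π i ∨ (π j : ℕ) < h)) := by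
  constructor
  · rintro ⟨i, j, k, ⟨hij, hjk, hπ, hor⟩, rfl⟩
    obtain ⟨j, rfl⟩ := Fin.exists_castSucc_eq.2 (Fin.ne_last_of_lt hjk)
    obtain ⟨i, rfl⟩ := Fin.exists_castSucc_eq.2 (Fin.ne_last_of_lt hij)
    simp only [append_castSucc, Fin.succAbove_lt_succAbove_iff, Fin.castSucc_lt_castSucc_iff]
      at hij hπ hor
    refine ⟨i, by rw [append_castSucc], ?_⟩
    induction k using Fin.lastCases with
    | last =>
      refine Or.inr ⟨j, hij, hπ, ?_⟩
      simp only [append_last, Fin.lt_def] at hor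
      have h1 := val_succAbove h (π i)
      have h2 := val_succAbove h (π j)
      omega
    | cast k =>
      simp only [append_castSucc, Fin.succAbove_lt_succAbove_iff] at hor
      exact Or.inl ⟨i, j, k, ⟨hij, hjk, hπ, hor⟩, rfl⟩
  · rintro ⟨i, rfl, ⟨i', j, k, ⟨hij, hjk, hπ, hor⟩, hi⟩ | ⟨j, hij, hπ, hor⟩⟩
    · obtain rfl : i' = i := π.injective (Fin.ext hi)
      refine ⟨i'.castSucc, j.castSucc, k.castSucc, ⟨hij, hjk, ?_, ?_⟩, by simp⟩
      · simpa using hπ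
      · simpa using hor
    · refine ⟨i.castSucc, j.castSucc, Fin.last n, ⟨hij, Fin.castSucc_lt_last j, ?_, ?_⟩, by simp⟩
      · simpa using hπ
      · simp only [append_castSucc, append_last, Fin.lt_def]
        have h1 := val_succAbove h (π i)
        have h2 := val_succAbove h (π j)
        omega

theorem hasAscent_append_iff {n : ℕ} (h : Fin (n + 1)) (π : Equiv.Perm (Fin n)) (b : ℕ) :
    HasAscent (append h π) b ↔ ∃ i : Fin n, (h.succAbove (π i) : ℕ) = b ∧
      (HasAscent π (π i) ∨ (π i : ℕ) < h) := by
  constructor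
  · rintro ⟨i, j, hij, hπ, rfl⟩
    obtain ⟨i, rfl⟩ := Fin.exists_castSucc_eq.2 (Fin.ne_last_of_lt hij)
    refine ⟨i, by rw [append_castSucc], ?_⟩
    induction j using Fin.lastCases with
    | last =>
      rw [append_castSucc, append_last, Fin.lt_def] at hπ
      have h1 := val_succAbove h (π i)
      omega
    | cast j =>
      simp only [append_castSucc, Fin.succAbove_lt_succAbove_iff] at hπ
      exact Or.inl ⟨i, j, hij, hπ, rfl⟩
  · rintro ⟨i, rfl, ⟨i', j, hij, hπ, hi⟩ | hlt⟩
    · obtain rfl : i' = i := π.injective (Fin.ext hi)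
      exact ⟨i'.castSucc, j.castSucc, hij, by simpa using hπ, by simp⟩
    · refine ⟨i.castSucc, Fin.last n, Fin.castSucc_lt_last i, ?_, by simp⟩
      rw [append_castSucc, append_last, Fin.lt_def]
      have h1 := val_succAbove h (π i)
      omega

theorem exists_apply_eq {n : ℕ} (π : Equiv.Perm (Fin n)) {b : ℕ} (hb : b < n) :
    ∃ i, (π i : ℕ) = b :=
  ⟨π.symm ⟨b, hb⟩, by simp⟩

theorem isBad_append_of_lt {n : ℕ} {h : Fin (n + 1)} {π : Equiv.Perm (Fin n)} {b : ℕ}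
    (hb : IsBad π b) (hlt : b < h) : IsBad (append h π) b := by
  obtain ⟨i, hi⟩ := exists_apply_eq π (show b < n by omega)
  refine (isBad_append_iff h π b).2 ⟨i, ?_, Or.inl (hi ▸ hb)⟩
  have := val_succAbove h (π i)
  omega

theorem exists_last_append {n : ℕ} (h : Fin (n + 1)) (π : Equiv.Perm (Fin n)) :
    ∃ i, (∀ j, j ≤ i) ∧ (append h π i : ℕ) = h :=
  ⟨Fin.last n, Fin.le_last, by rw [append_last]⟩

theorem HasAscent.of_lt {n : ℕ} {π : Equiv.Perm (Fin n)} {i j : Fin n} (hij : i < j)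
    (h : π i < π j) : HasAscent π (π i) :=
  ⟨i, j, hij, h, rfl⟩

/-- The top ascending entry `m + p - 1` is raised to `m + p` and starts a 231 ending in `h`; nothing
above it has an ascent. -/
theorem IsState.append_of_lt {n : ℕ} {π : Equiv.Perm (Fin n)} {m p : ℕ} (hs : IsState π m p)
    {h : Fin (n + 1)} (hm : m ≤ h) (hlt : (h : ℕ) < m + p) :
    IsState (append h π) (m + p + 1) 0 where
  le := by have := hs.le; omega
  bad := by
    right
    have hle := hs.le
    obtain ⟨i, hi⟩ := exists_apply_eq π (show m + p - 1 < n by omega)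
    have hv := val_succAbove h (π i)
    obtain ⟨i', j, hij, hπ, hi'⟩ := (hs.ascent_iff (π i) (by omega)).2 (by omega)
    obtain rfl : i' = i := π.injective (Fin.ext hi')
    exact (isBad_append_iff h π _).2 ⟨i', by omega, Or.inr ⟨j, hij, hπ, by omega⟩⟩
  not_bad b hb := by
    rw [isBad_append_iff]
    rintro ⟨i, rfl, hbad | ⟨j, hij, hπ, -⟩⟩
    all_goals have hv := val_succAbove h (π i)
    · exact hs.not_bad _ (by omega) hbad
    · have := (hs.ascent_iff (π i) (by omega)).1 (.of_lt hij hπ)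
      omega
  ascent_iff b hb := by
    refine ⟨fun ha => ?_, fun _ => by omega⟩
    obtain ⟨i, rfl, ha | hlt'⟩ := (hasAscent_append_iff h π b).1 ha
    all_goals have hv := val_succAbove h (π i)
    · have := (hs.ascent_iff (π i) (by omega)).1 ha
      omega
    · omega
  last h0 := absurd h0 (lt_irrefl _)

theorem IsState.append_of_eq {n : ℕ} {π : Equiv.Perm (Fin n)} {m p : ℕ} (hs : IsState π m p)
    {h : Fin (n + 1)} (heq : (h : ℕ) = m + p) : IsState (append h π) m p where
  le := by have := hs.le; omega
  bad := by
    rcases Nat.eq_zero_or_pos m with h0 | h0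
    · exact Or.inl h0
    · exact Or.inr (isBad_append_of_lt (hs.bad.resolve_left h0.ne') (by omega))
  not_bad b hb := by
    rw [isBad_append_iff]
    rintro ⟨i, rfl, hbad | ⟨j, hij, hπ, hor⟩⟩
    all_goals have hv := val_succAbove h (π i)
    · exact hs.not_bad _ (by omega) hbad
    · have hlt := (hs.ascent_iff (π i) (by omega)).1 (.of_lt hij hπ)
      -- A new 123 ending in `h = m + p` would already be a 123 in `π`, ending in the old last entry
      -- `m + p`.
      obtain ⟨l, hl, hπl⟩ := hs.last (by omega)
      have hjl : j < l := lt_of_le_of_ne (hl j) (by rintro rfl; omega)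
      refine hs.not_bad (π i) (by omega) ⟨i, j, l, ⟨hij, hjl, hπ, Or.inr ?_⟩, rfl⟩
      rw [Fin.lt_def]
      omega
  ascent_iff b hb := by
    rw [hasAscent_append_iff]
    constructor
    · rintro ⟨i, rfl, ha | hlt⟩
      all_goals have hv := val_succAbove h (π i)
      · have := (hs.ascent_iff (π i) (by omega)).1 ha
        omega
      · omega
    · intro hlt
      obtain ⟨i, hi⟩ := exists_apply_eq π (show b < n by omega)
      have hv := val_succAbove h (π i)
      exact ⟨i, by omega, Or.inr (by omega)⟩
  last _ := heq ▸ exists_last_append h π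

/-- If `p > 0`, the entry `m + p - 1`, the old last entry `m + p` and `h` form a 123. The entries
from `m + p` up to `h - 1` now ascend to `h`. -/
theorem IsState.append_of_gt {n : ℕ} {π : Equiv.Perm (Fin n)} {m p : ℕ} (hs : IsState π m p)
    {h : Fin (n + 1)} (hgt : m + p < h) : IsState (append h π) (m + p) (h - (m + p)) where
  le := by omega
  bad := by
    rcases Nat.eq_zero_or_pos p with rfl | hp
    · rcases Nat.eq_zero_or_pos m with h0 | h0
      · exact Or.inl h0
      · exact Or.inr (isBad_append_of_lt (hs.bad.resolve_left h0.ne') (by omega))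
    · right
      obtain ⟨l, hl, hπl⟩ := hs.last hp
      obtain ⟨i, hi⟩ := exists_apply_eq π (show m + p - 1 < n by omega)
      have hv := val_succAbove h (π i)
      have hil : i < l := lt_of_le_of_ne (hl i) (by rintro rfl; omega)
      exact (isBad_append_iff h π _).2
        ⟨i, by omega, Or.inr ⟨l, hil, by rw [Fin.lt_def]; omega, by omega⟩⟩
  not_bad b hb := by
    rw [isBad_append_iff]
    rintro ⟨i, rfl, hbad | ⟨j, hij, hπ, hor⟩⟩
    all_goals have hv := val_succAbove h (π i)
    · exact hs.not_bad _ (by omega) hbad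
    · have hlt := (hs.ascent_iff (π i) (by omega)).1 (.of_lt hij hπ)
      omega
  ascent_iff b hb := by
    rw [hasAscent_append_iff]
    constructor
    · rintro ⟨i, rfl, ha | hlt⟩
      all_goals have hv := val_succAbove h (π i)
      · have := (hs.ascent_iff (π i) (by omega)).1 ha
        omega
      · omega
    · intro hlt
      obtain ⟨i, hi⟩ := exists_apply_eq π (show b < n by omega)
      have hv := val_succAbove h (π i)
      exact ⟨i, by omega, Or.inr (by omega)⟩
  last _ := by
    obtain ⟨i, hi, hv⟩ := exists_last_append h π
    exact ⟨i, hi, by omega⟩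

/-! ### The succession rule and weighted sums over avoiders. -/

/-- The state of `append h π` in terms of the state of `π`. -/
def step (q : ℕ × ℕ) (h : ℕ) : ℕ × ℕ :=
  if h < q.1 + q.2 then (q.1 + q.2 + 1, 0)
  else if h = q.1 + q.2 then q
  else (q.1 + q.2, h - (q.1 + q.2))

/-- The state of a permutation, computed by building it up from left to right. -/
noncomputable def state : (n : ℕ) → Equiv.Perm (Fin n) → ℕ × ℕ
  | 0, _ => (0, 0)
  | n + 1, π => step (state n ((appendEquiv n).symm π).2) ((appendEquiv n).symm π).1

theorem state_append {n : ℕ} (h : Fin (n + 1)) (π : Equiv.Perm (Fin n)) :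
    state (n + 1) (append h π) = step (state n π) h := by
  have : (appendEquiv n).symm (append h π) = (h, π) :=
    (appendEquiv n).symm_apply_eq.2 rfl
  rw [state, this]

theorem exists_eq_append {n : ℕ} (π : Equiv.Perm (Fin (n + 1))) :
    ∃ (h : Fin (n + 1)) (π' : Equiv.Perm (Fin n)), π = append h π' :=
  ⟨((appendEquiv n).symm π).1, ((appendEquiv n).symm π).2,
    ((appendEquiv n).apply_symm_apply π).symm⟩

theorem isState_state {n : ℕ} {π : Equiv.Perm (Fin n)} (hπ : Avoids π) :
    IsState π (state n π).1 (state n π).2 := by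
  induction n with
  | zero =>
    refine ⟨le_rfl, Or.inl rfl, ?_, ?_, ?_⟩
    · rintro b - ⟨i, -⟩
      exact i.elim0
    · intro b _
      refine ⟨?_, fun h => absurd h (Nat.not_lt_zero b)⟩
      rintro ⟨i, -⟩
      exact i.elim0
    · exact fun h => absurd h (lt_irrefl 0)
  | succ n ih =>
    obtain ⟨h, π, rfl⟩ := exists_eq_append π
    obtain ⟨hav, hb⟩ := (avoids_append_iff h π).1 hπ
    have hs := ih hav
    have hm := (hs.active_iff h).1 hb
    rw [state_append, step]
    split_ifs with h1 h2
    · exact hs.append_of_lt hm h1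
    · exact hs.append_of_eq h2
    · exact hs.append_of_gt (by omega)

open Classical in
/-- The sum over the avoiders `π` of length `n` of `w p d`, where `(m, p)` is the state of `π` and
`n = m + p + d`. -/
noncomputable def stateSum {R : Type*} [CommRing R] (n : ℕ) (w : ℕ → ℕ → R) : R :=
  ∑ π : Equiv.Perm (Fin n) with Avoids π,
    w (state n π).2 (n - (state n π).1 - (state n π).2)

theorem sum_step {R : Type*} [CommRing R] {n m p : ℕ} (hn : m + p ≤ n) (w : ℕ → ℕ → R) :
    ∑ h : Fin (n + 1), (if m ≤ h then
        w (step (m, p) h).2 (n + 1 - (step (m, p) h).1 - (step (m, p) h).2) else 0)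
      = p * w 0 (n - m - p) + w p (n - m - p + 1)
        + ∑ i ∈ Finset.range (n - m - p), w (i + 1) (n - m - p - i) := by
  obtain ⟨d, rfl⟩ := Nat.exists_eq_add_of_le hn
  rw [Fin.sum_univ_eq_sum_range (fun h => if m ≤ h then
        w (step (m, p) h).2 (m + p + d + 1 - (step (m, p) h).1 - (step (m, p) h).2) else 0),
    -- The blocks are the `m` forbidden values, the `p` values below `m + p`, the value `m + p`
    -- itself, and the `d` values above it.
    show m + p + d + 1 = m + (p + (d + 1)) by omega, Finset.sum_range_add, Finset.sum_range_add,
    Finset.sum_range_succ']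
  have e0 : m + p + d - m - p = d := by omega
  rw [e0, Finset.sum_eq_zero, zero_add, add_comm (Finset.sum _ _) (ite _ _ _), ← add_assoc]
  · congr 1
    · congr 1
      · rw [Finset.sum_congr rfl (g := fun _ => w 0 d), Finset.sum_const, Finset.card_range,
          nsmul_eq_mul]
        intro h hh
        have := Finset.mem_range.1 hh
        rw [if_pos (by omega), step, if_pos (by simpa using this)]
        congr 1
        simp only
        omega
      · rw [if_pos (by omega), step, if_neg (by simp), if_pos (by simp)]
        congr 1
        simp only
        omega
    · refine Finset.sum_congr rfl fun i hi => ?_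
      have := Finset.mem_range.1 hi
      rw [if_pos (by omega), step, if_neg (by simp only; omega), if_neg (by simp only; omega)]
      congr 1 <;> simp only <;> omega
  · intro h hh
    have := Finset.mem_range.1 hh
    rw [if_neg (by omega)]

theorem stateSum_succ {R : Type*} [CommRing R] (n : ℕ) (w : ℕ → ℕ → R) :
    stateSum (n + 1) w = stateSum n fun p d =>
      p * w 0 d + w p (d + 1) + ∑ i ∈ Finset.range d, w (i + 1) (d - i) := by
  classical
  rw [stateSum, stateSum, Finset.sum_filter, ← (appendEquiv n).sum_comp,
    Fintype.sum_prod_type_right, Finset.sum_filter]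
  refine Finset.sum_congr rfl fun π _ => ?_
  split_ifs with hπ
  · have hs := isState_state hπ
    rw [← sum_step hs.le]
    refine Finset.sum_congr rfl fun h _ => ?_
    have : Avoids (appendEquiv n (h, π)) ↔ (state n π).1 ≤ h :=
      (avoids_append_iff h π).trans ((and_iff_right hπ).trans (hs.active_iff h))
    rw [if_congr this rfl rfl, show appendEquiv n (h, π) = append h π from rfl, state_append]
  · refine Finset.sum_eq_zero fun h _ => if_neg fun hav => hπ ?_
    exact ((avoids_append_iff h π).1 hav).1

theorem stateSum_zero {R : Type*} [CommRing R] (w : ℕ → ℕ → R) : stateSum 0 w = w 0 0 := by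
  classical
  rw [stateSum, Finset.filter_true_of_mem (fun π _ i => i.elim0)]
  simp [state]

theorem stateSum_one {R : Type*} [CommRing R] (n : ℕ) :
    stateSum n (fun _ _ => (1 : R)) = ((avoiders {p3412, p3421, p2341} n).ncard : R) := by
  classical
  rw [stateSum, Finset.sum_const, nsmul_eq_mul, mul_one, ← Set.ncard_coe_finset]
  congr 2
  ext π
  simp [mem_avoiders_iff]

theorem stateSum_add {R : Type*} [CommRing R] (n : ℕ) (w w' : ℕ → ℕ → R) :
    stateSum n (fun p d => w p d + w' p d) = stateSum n w + stateSum n w' :=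
  Finset.sum_add_distrib

theorem stateSum_mul_left {R : Type*} [CommRing R] (n : ℕ) (c : R) (w : ℕ → ℕ → R) :
    stateSum n (fun p d => c * w p d) = c * stateSum n w :=
  (Finset.mul_sum _ _ _).symm

/-! ### The functional equations for `A` and `B`. -/

theorem one_sub_mul_sum_pow {R : Type*} [CommRing R] (u : R) (d : ℕ) :
    (1 - u) * ∑ i ∈ Finset.range d, u ^ (d - i) = u * (1 - u ^ d) := by
  induction d with
  | zero => simp
  | succ d ih =>
    rw [Finset.sum_range_succ']
    simp only [Nat.add_sub_add_right, Nat.sub_zero]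
    linear_combination ih

theorem one_sub_sq_mul_sum_mul_pow {R : Type*} [CommRing R] (u : R) (d : ℕ) :
    (1 - u) ^ 2 * ∑ i ∈ Finset.range d, ((i + 1 : ℕ) : R) * u ^ (d - i)
      = u * ((1 - u) * d - u * (1 - u ^ d)) := by
  induction d with
  | zero => simp
  | succ d ih =>
    rw [Finset.sum_range_succ']
    simp only [Nat.add_sub_add_right, Nat.sub_zero]
    have h : ∑ i ∈ Finset.range d, ((i + 1 + 1 : ℕ) : R) * u ^ (d - i)
        = ∑ i ∈ Finset.range d, ((i + 1 : ℕ) : R) * u ^ (d - i)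
          + ∑ i ∈ Finset.range d, u ^ (d - i) := by
      rw [← Finset.sum_add_distrib]
      exact Finset.sum_congr rfl fun i _ => by push_cast; ring
    rw [h]
    push_cast at ih ⊢
    linear_combination ih + (1 - u) * one_sub_mul_sum_pow u d

theorem one_sub_mul_stateSum_succ {R : Type*} [CommRing R] (u : R) (n : ℕ) :
    (1 - u) * stateSum (n + 1) (fun _ d => u ^ d)
      = (1 - u) * stateSum n (fun p d => (p : R) * u ^ d)
        + ((u * (1 - u) - u) * stateSum n (fun _ d => u ^ d) + u * stateSum n fun _ _ => 1) := by
  rw [stateSum_succ]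
  simp only [← stateSum_mul_left, ← stateSum_add]
  congr 1
  funext p d
  linear_combination one_sub_mul_sum_pow u d

theorem one_sub_sq_mul_stateSum_succ {R : Type*} [CommRing R] (u : R) (n : ℕ) :
    (1 - u) ^ 2 * stateSum (n + 1) (fun p d => (p : R) * u ^ d)
      = u * (1 - u) ^ 2 * stateSum n (fun p d => (p : R) * u ^ d)
        + (u * (1 - u) * stateSum n (fun _ d => (d : R))
          + ((-u ^ 2) * stateSum n (fun _ _ => 1) + u ^ 2 * stateSum n fun _ d => u ^ d)) := by
  rw [stateSum_succ]
  simp only [← stateSum_mul_left, ← stateSum_add]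
  congr 1
  funext p d
  push_cast
  have h := one_sub_sq_mul_sum_mul_pow u d
  push_cast at h
  linear_combination h

theorem genFun_eq_xSum :
    genFun {p3412, p3421, p2341} = xSum fun n => stateSum n fun _ _ => 1 := by
  rw [genFun, ← xSum_C]
  congr 1
  funext n
  rw [stateSum_one]
  exact map_natCast _ _

theorem genFun_relation {k r : ℝ⟦X⟧} (hk : k ^ 2 = k + 1)
    (h : PowerSeries.X * (1 + k * r) * (1 + r) = r) :
    k * genFun {p3412, p3421, p2341}
      = k * (1 + r) - PowerSeries.X * xSum (fun n => stateSum n fun _ d => (d : ℝ⟦X⟧))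
        * (1 + r) := by
  refine kernel_method (u := 1 + k * r)
    (A := xSum fun n => stateSum n fun _ d => (1 + k * r) ^ d)
    (B := xSum fun n => stateSum n fun p d => (p : ℝ⟦X⟧) * (1 + k * r) ^ d)
    (branch_ne_zero h) hk h rfl ?_ ?_
  all_goals
    generalize 1 + k * r = u
    rw [genFun_eq_xSum]
  · conv_lhs => rw [xSum_succ, mul_add, mul_left_comm, ← xSum_mul_left]
    simp only [one_sub_mul_stateSum_succ, xSum_add, xSum_mul_left, stateSum_zero]
    ring
  · conv_lhs => rw [xSum_succ, mul_add, mul_left_comm, ← xSum_mul_left]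
    simp only [one_sub_sq_mul_stateSum_succ, xSum_add, xSum_mul_left, stateSum_zero]
    push_cast
    ring

end PatternAvoidance

/-! ### Assembling the formula in Laurent series. -/

theorem mainTheorem7 :
    ∃ r t : ℝ⟦X⟧,
      (r : ℝ⸨X⸩) = PatternAvoidance.branch (Real.sqrt 5) ∧
      (t : ℝ⸨X⸩) = PatternAvoidance.branch (-Real.sqrt 5) ∧
      PatternAvoidance.kernel (r + 1) = 0 ∧
      PatternAvoidance.kernel (t + 1) = 0 ∧
      r ≠ 0 ∧ t ≠ 0 ∧
      1 + 1 / (r : ℝ⸨X⸩) + 1 / (t : ℝ⸨X⸩) - 1 / ((PowerSeries.X : ℝ⟦X⟧) : ℝ⸨X⸩) ≠ 0 ∧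
      ((PatternAvoidance.genFun
          {PatternAvoidance.p3412, PatternAvoidance.p3421, PatternAvoidance.p2341} : ℝ⟦X⟧) :
          ℝ⸨X⸩) =
        1 + (1 + (r : ℝ⸨X⸩) * (t : ℝ⸨X⸩)) /
          (1 + 1 / (r : ℝ⸨X⸩) + 1 / (t : ℝ⸨X⸩)
            - 1 / ((PowerSeries.X : ℝ⟦X⟧) : ℝ⸨X⸩)) := by
  have hs : Real.sqrt 5 ^ 2 = 5 := Real.sq_sqrt (by norm_num)
  have hs' : (-Real.sqrt 5) ^ 2 = 5 := by rw [neg_sq, hs]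
  obtain ⟨r, hrb, hr⟩ := PatternAvoidance.exists_branch hs
  obtain ⟨t, htb, ht⟩ := PatternAvoidance.exists_branch hs'
  have hkr := PatternAvoidance.kernel_branch hs hr
  have hkt := PatternAvoidance.kernel_branch hs' ht
  have hr0 := PatternAvoidance.branch_ne_zero hr
  have ht0 := PatternAvoidance.branch_ne_zero ht
  have hrc := PatternAvoidance.constantCoeff_branch hr
  have htc := PatternAvoidance.constantCoeff_branch ht
  refine ⟨r, t, hrb, htb, hkr, hkt, hr0, ht0, ?_⟩
  have hk := PatternAvoidance.C_half_one_add_sq hs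
  have hFr := PatternAvoidance.genFun_relation hk hr
  have hFt := PatternAvoidance.genFun_relation (PatternAvoidance.C_half_one_add_sq hs') ht
  have hconj : (PowerSeries.C ((1 + -Real.sqrt 5) / 2) : ℝ⟦X⟧)
      = 1 - PowerSeries.C ((1 + Real.sqrt 5) / 2) := by
    rw [← map_one PowerSeries.C, ← map_sub]
    ring_nf
  rw [hconj] at hFt ht
  -- The constant term is `2 k - 1 = √5`.
  have hne : (PowerSeries.C ((1 + Real.sqrt 5) / 2) : ℝ⟦X⟧) * (1 + t)
      - (1 - PowerSeries.C ((1 + Real.sqrt 5) / 2)) * (1 + r) ≠ 0 := by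
    intro h0
    have h1 := congrArg PowerSeries.constantCoeff h0
    simp only [map_sub, map_mul, map_add, map_one, map_zero, hrc, htc,
      PowerSeries.constantCoeff_C] at h1
    have : Real.sqrt 5 = 0 := by linarith
    rw [this] at hs
    norm_num at hs
  have hF := PatternAvoidance.closed_form PowerSeries.X_ne_zero hk hr ht hne hFr hFt
  have h1rt : 1 - r * t ≠ 0 := by
    intro h0
    simpa [hrc] using congrArg PowerSeries.constantCoeff h0
  have h1r : 1 + r ≠ 0 := by
    intro h0
    simpa [hrc] using congrArg PowerSeries.constantCoeff h0
  have h1t : 1 + t ≠ 0 := by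
    intro h0
    simpa [htc] using congrArg PowerSeries.constantCoeff h0
  -- This is `1 + 1/r + 1/t - 1/x = (1 - r t) / (x (1 + r) (1 + t))` with denominators cleared.
  have hsum : PowerSeries.X * (r * t + r + t) * ((1 + r) * (1 + t)) - r * t * ((1 + r) * (1 + t))
      = r * t * (1 - r * t) := by
    linear_combination t * (1 + t) * hr + r * (1 + r) * ht
  generalize PatternAvoidance.genFun
    {PatternAvoidance.p3412, PatternAvoidance.p3421, PatternAvoidance.p2341} = F at hF ⊢
  set φ := HahnSeries.ofPowerSeries ℤ ℝ with hφ
  have hinj : Function.Injective φ := HahnSeries.ofPowerSeries_injective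
  have hX := (map_ne_zero_iff φ hinj).2 (PowerSeries.X_ne_zero (R := ℝ))
  replace hr0 := (map_ne_zero_iff φ hinj).2 hr0
  replace ht0 := (map_ne_zero_iff φ hinj).2 ht0
  replace h1rt := (map_ne_zero_iff φ hinj).2 h1rt
  replace h1r := (map_ne_zero_iff φ hinj).2 h1r
  replace h1t := (map_ne_zero_iff φ hinj).2 h1t
  replace hF := congrArg φ hF
  replace hsum := congrArg φ hsum
  simp only [map_sub, map_mul, map_add, map_one] at hF hsum h1rt h1r h1t
  have hden : 1 + 1 / φ r + 1 / φ t - 1 / φ PowerSeries.X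
      = (1 - φ r * φ t) / (φ PowerSeries.X * ((1 + φ r) * (1 + φ t))) := by
    field_simp
    linear_combination hsum
  rw [hden]
  refine ⟨div_ne_zero h1rt (mul_ne_zero hX (mul_ne_zero h1r h1t)), ?_⟩
  field_simp
  linear_combination hF
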